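/- Let $p,q$ be positive integers with $2<\frac pq<4$. The circular clique $G_{p,q}$ has vertex set $\{0,1,\dots,p-1\}$, with $u$ and $v$ adjacent if and only if $q\le|u-v|\le p-q$. Let $G$ be a finite simple graph. A $(p,q)$-colouring of $G$ is a homomorphism $f\colon G\to G_{p,q}$. The reconfiguration graph $\mathbf{Col}(G,G_{p,q})$ has the $(p,q)$-colourings of $G$ as its vertices, two of them being adjacent if they differ on at most one vertex of $G$. The graph $G$ is called $(p,q)$-mixing if $\mathbf{Col}(G,G_{p,q})$ is connected, i.e. any two $(p,q)$-colourings of $G$ are joined by a path in it (if $G$ has no $(p,q)$-colouring, this holds vacuously). For a $(p,q)$-colouring $f$ and an edge $uv$ traversed from $u$ to $v$, let $W(uv,f)\in\{0,\dots,p-1\}$ be the residue of $f(v)-f(u)$ modulo $p$. For a cycle $C=c_0,c_1,\dots,c_{l-1},c_l=c_0$ of $G$ with a chosen direction of traversal, let $W(C,f)=\sum_{i=1}^{l}W(c_{i-1}c_i,f)$. This is a multiple of $p$, and the wind of $C$ under $f$ is the integer $w_f(C)$ with $W(C,f)=p\cdot w_f(C)$. Then $G$ is $(p,q)$-mixing if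 and only if $w_f(C)=\frac{|E(C)|}{2}$ for every $(p,q)$-colouring $f$ of $G$ and every cycle $C$ of $G$. Equivalently, $G$ is not $(p,q)$-mixing if and only if there are a $(p,q)$-colouring $f$ of $G$ and a cycle $C$ of $G$ with $W(C,f)\ne\frac{|E(C)|}{2}\,p$. -/

import Mathlib

namespace CircularMixing

/-- The circular clique `G_{p,q}` on `{0, …, p-1}`: `u` and `v` are adjacent iff
`q ≤ |u - v| ≤ p - q`. For `q ≥ 1` the clause `u ≠ v` is redundant. -/
def circularClique (p q : ℕ) : SimpleGraph (Fin p) where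
  Adj u v := u ≠ v ∧ (q : ℤ) ≤ |(u : ℤ) - (v : ℤ)| ∧ |(u : ℤ) - (v : ℤ)| ≤ (p : ℤ) - (q : ℤ)
  symm := ⟨fun u v h => by rwa [ne_comm, abs_sub_comm] at h⟩
  loopless := ⟨fun _ h => h.1 rfl⟩

/-- A `(p,q)`-colouring of `G` is a homomorphism from `G` to the circular clique `G_{p,q}`. -/
abbrev Colouring {V : Type*} (G : SimpleGraph V) (p q : ℕ) : Type _ :=
  G →g circularClique p q

/-- The reconfiguration graph `Col(G, H)`: its vertices are the homomorphisms from `G` to `H`,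
and two of them are adjacent iff they differ on at most one vertex of `G`. Loops are left out,
which does not affect paths or connectedness. -/
def reconfigurationGraph {V W : Type*} (G : SimpleGraph V) (H : SimpleGraph W) :
    SimpleGraph (G →g H) where
  Adj f g := f ≠ g ∧ {v | f v ≠ g v}.Subsingleton
  symm := ⟨fun f g h => ⟨h.1.symm, by simpa only [ne_comm] using h.2⟩⟩
  loopless := ⟨fun _ h => h.1 rfl⟩

/-- `G` is `(p,q)`-mixing: any two `(p,q)`-colourings of `G` are joined by a path in
`Col(G, G_{p,q})`. The graph without vertices thus counts as connected; for a graph `G` that has a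
`(p,q)`-colouring this is `SimpleGraph.Connected`, see `isMixing_iff_connected`. -/
def IsMixing {V : Type*} (G : SimpleGraph V) (p q : ℕ) : Prop :=
  (reconfigurationGraph G (circularClique p q)).Preconnected

theorem isMixing_iff_connected {V : Type*} (G : SimpleGraph V) (p q : ℕ)
    [h : Nonempty (Colouring G p q)] :
    IsMixing G p q ↔ (reconfigurationGraph G (circularClique p q)).Connected :=
  ⟨fun hG => ⟨hG⟩, fun hG => hG.preconnected⟩

/-- The weight `W(uv, f) = (f(v) - f(u)) mod p`, an integer in `{0, …, p-1}`. -/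
def edgeWeight {V : Type*} {p : ℕ} (f : V → Fin p) (u v : V) : ℤ :=
  ((f v : ℤ) - (f u : ℤ)) % (p : ℤ)

/-- The weight `W(X, f)` of a walk: the sum of the weights of its edges, each in the direction in
which the walk traverses it. -/
def walkWeight {V : Type*} {G : SimpleGraph V} {p : ℕ} (f : V → Fin p) {u v : V}
    (X : G.Walk u v) : ℤ :=
  (X.darts.map fun d => edgeWeight f d.fst d.snd).sum

/-- The wind `w_f(C)` of a closed walk, the integer with `W(C, f) = p * w_f(C)`
(see `walkWeight_eq_mul_wind`: the division is exact). -/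
def wind {V : Type*} {G : SimpleGraph V} {p : ℕ} (f : V → Fin p) {u : V}
    (C : G.Walk u u) : ℤ :=
  walkWeight f C / (p : ℤ)

theorem walkWeight_modEq {V : Type*} {G : SimpleGraph V} {p : ℕ} (f : V → Fin p) {u v : V}
    (X : G.Walk u v) : walkWeight f X ≡ (f v : ℤ) - (f u : ℤ) [ZMOD p] := by
  induction X with
  | nil => simp [walkWeight]
  | @cons a b c h X ih =>
    have e : walkWeight f (SimpleGraph.Walk.cons h X) = edgeWeight f a b + walkWeight f X := by
      simp [walkWeight]
    have hb : edgeWeight f a b ≡ (f b : ℤ) - (f a : ℤ) [ZMOD p] := Int.mod_modEq _ _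
    rw [e]
    convert hb.add ih using 1
    ring

theorem walkWeight_eq_mul_wind {V : Type*} {G : SimpleGraph V} {p : ℕ} (f : V → Fin p) {u : V}
    (C : G.Walk u u) : walkWeight f C = (p : ℤ) * wind f C := by
  have h := walkWeight_modEq f C
  rw [sub_self] at h
  exact (Int.mul_ediv_cancel' (Int.modEq_zero_iff_dvd.mp h)).symm

end CircularMixing

/-! Necessity: recolouring one vertex changes the edge weights by a coboundary
(`exists_edgeWeight_eq_add_sub`, where `p < 4 * q` enters), so weights of closed walks are constant
on components of the reconfiguration graph. Reversing the colour order turns weight `W` into `length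
* p - W`; if both colourings are connected, `2 * W = length * p`.

Sufficiency: the balance condition forces even cycles, hence a bipartition, and makes the
obstruction to lifting a colouring to integers a coboundary (`Colouring.exists_isLift`). Of two
lifts, one can be shifted above the other by a multiple of `p`. The lower one is then raised by 1 at
one vertex at a time, and a suitable extremal vertex is never blocked
(`IsLift.exists_isLift_update`). -/

namespace CircularMixing

open SimpleGraph

/-! ### Weights vanishing on cycles are coboundaries -/

section Potential

variable {V A : Type*} {G : SimpleGraph V} [AddCommGroup A]

/-- The sum of `w` over the darts of a walk. -/
def dartSum (w : V → V → A) {u v : V} (X : G.Walk u v) : A :=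
  (X.darts.map fun d => w d.fst d.snd).sum

@[simp]
theorem dartSum_nil (w : V → V → A) (u : V) : dartSum w (Walk.nil : G.Walk u u) = 0 := by
  simp [dartSum]

@[simp]
theorem dartSum_cons (w : V → V → A) {u v x : V} (h : G.Adj u v) (X : G.Walk v x) :
    dartSum w (Walk.cons h X) = w u v + dartSum w X := by
  simp [dartSum]

@[simp]
theorem dartSum_append (w : V → V → A) {u v x : V} (X : G.Walk u v) (Y : G.Walk v x) :
    dartSum w (X.append Y) = dartSum w X + dartSum w Y := by
  simp [dartSum]

/-- Weights that differ by a coboundary have walk sums that differ by a boundary term. -/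
theorem dartSum_eq_add_sub {w w' : V → V → A} {φ : V → A}
    (h : ∀ u v, G.Adj u v → w' u v = w u v + (φ v - φ u)) {u v : V} (X : G.Walk u v) :
    dartSum w' X = dartSum w X + (φ v - φ u) := by
  induction X with
  | nil => simp
  | cons hadj X ih =>
    rw [dartSum_cons, dartSum_cons, ih, h _ _ hadj]
    abel

/-- An antisymmetric weight that vanishes on cycles is not changed by making a walk a path. -/
theorem dartSum_bypass [DecidableEq V] {w : V → V → A}
    (hw : ∀ u v, G.Adj u v → w u v + w v u = 0)
    (hC : ∀ (c : V) (C : G.Walk c c), C.IsCycle → dartSum w C = 0) {u v : V} (X : G.Walk u v) :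
    dartSum w X.bypass = dartSum w X := by
  induction X with
  | nil => rfl
  | @cons a b c h X ih =>
    rw [Walk.bypass, dartSum_cons, ← ih]
    split_ifs with hs
    · have hpath : (X.bypass.takeUntil a hs).IsPath := X.bypass_isPath.takeUntil hs
      have hsum : dartSum w (Walk.cons h (X.bypass.takeUntil a hs)) = 0 := by
        -- The removed detour is either an edge walked back and forth or a genuine cycle.
        by_cases he : s(a, b) ∈ (X.bypass.takeUntil a hs).edges
        · rw [hpath.eq_adj_toWalk_of_mem_edges (by rwa [Sym2.eq_swap])]
          simpa using hw a b h
        · exact hC _ _ ((Walk.cons_isCycle_iff _ h).2 ⟨hpath, he⟩)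
      conv_rhs => rw [← X.bypass.take_spec hs]
      rw [dartSum_append, ← add_assoc, ← dartSum_cons w h, hsum, zero_add]
    · rw [dartSum_cons]

/-- An antisymmetric weight that vanishes on cycles vanishes on closed walks. -/
theorem dartSum_eq_zero_of_isCycle {w : V → V → A}
    (hw : ∀ u v, G.Adj u v → w u v + w v u = 0)
    (hC : ∀ (c : V) (C : G.Walk c c), C.IsCycle → dartSum w C = 0) {u : V} (X : G.Walk u u) :
    dartSum w X = 0 := by
  classical
  rw [← dartSum_bypass hw hC, (Walk.isPath_iff_nil.1 X.bypass_isPath).eq_nil, dartSum_nil]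

/-- An antisymmetric weight that vanishes on cycles is a coboundary. -/
theorem exists_potential {w : V → V → A}
    (hw : ∀ u v, G.Adj u v → w u v + w v u = 0)
    (hC : ∀ (c : V) (C : G.Walk c c), C.IsCycle → dartSum w C = 0) :
    ∃ φ : V → A, ∀ u v, G.Adj u v → φ v - φ u = w u v := by
  have hr (v : V) : G.Reachable (G.connectedComponentMk v).out v :=
    ConnectedComponent.exact (Quot.out_eq _)
  let X (v : V) := (hr v).some
  refine ⟨fun v => dartSum w (X v), fun u v h => ?_⟩
  have hroot : (G.connectedComponentMk v).out = (G.connectedComponentMk u).out := by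
    rw [ConnectedComponent.eq.2 h.reachable]
  -- The root is generalized because the representatives for `u` and `v` are equal only
  -- propositionally.
  have key : ∀ (r : V) (Y : G.Walk r v), r = (G.connectedComponentMk u).out →
      dartSum w Y - dartSum w (X u) = w u v := by
    rintro r Y rfl
    have e1 := dartSum_eq_zero_of_isCycle hw hC (((X u).append h.toWalk).append Y.reverse)
    have e2 := dartSum_eq_zero_of_isCycle hw hC (Y.append Y.reverse)
    simp only [dartSum_append, Adj.toWalk, dartSum_cons, dartSum_nil] at e1 e2
    rw [eq_neg_of_add_eq_zero_left e2, sub_eq_iff_eq_add]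
    rw [← eq_neg_of_add_eq_zero_left e1]
    abel
  exact key _ (X v) hroot

end Potential

/-! ### Edge weights of colourings -/

section CircularClique

variable {V : Type*} {G : SimpleGraph V} {p q : ℕ}

theorem circularClique_adj_iff (hq : 0 < q) (a b : Fin p) :
    (circularClique p q).Adj a b ↔
      (q : ℤ) ≤ ((b : ℤ) - a) % p ∧ ((b : ℤ) - a) % p ≤ (p : ℤ) - q := by
  have ha := a.isLt
  have hb := b.isLt
  change (a ≠ b ∧ _ ∧ _) ↔ _
  rw [Ne, Fin.ext_iff]
  rcases lt_or_ge (b : ℕ) (a : ℕ) with h | h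
  · have e : ((b : ℤ) - a) % p = (b : ℤ) - a + p := by
      rw [← Int.add_emod_right, Int.emod_eq_of_lt] <;> omega
    rw [e, abs_of_nonneg (by omega)]
    omega
  · rw [Int.emod_eq_of_lt (by omega) (by omega), abs_of_nonpos (by omega)]
    omega

theorem Colouring.edgeWeight_mem (hq : 0 < q) (f : Colouring G p q) {u v : V} (h : G.Adj u v) :
    (q : ℤ) ≤ edgeWeight f u v ∧ edgeWeight f u v ≤ (p : ℤ) - q :=
  (circularClique_adj_iff hq _ _).1 (f.map_adj h)

theorem edgeWeight_eq (f : V → Fin p) (u v : V) :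
    edgeWeight f u v = (f v : ℤ) - f u + p * (if f v < f u then 1 else 0) := by
  have hu := (f u).isLt
  have hv := (f v).isLt
  rw [edgeWeight]
  split_ifs with h
  · rw [Fin.lt_def] at h
    rw [← Int.add_emod_right, Int.emod_eq_of_lt] <;> omega
  · rw [Fin.lt_def] at h
    rw [Int.emod_eq_of_lt] <;> omega

/-- The end colours differ, so exactly one of the two directions wraps around. -/
theorem Colouring.edgeWeight_add_edgeWeight_swap (f : Colouring G p q) {u v : V}
    (h : G.Adj u v) : edgeWeight f u v + edgeWeight f v u = p := by
  have hne : f u ≠ f v := (f.map_adj h).ne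
  rw [edgeWeight_eq, edgeWeight_eq]
  rcases lt_or_gt_of_ne hne with h' | h'
  · rw [if_neg h'.not_gt, if_pos h']; ring
  · rw [if_neg h'.not_gt, if_pos h']; ring

end CircularClique

/-! ### Invariance of weights and colour reversal -/

section Invariance

variable {V : Type*} {G : SimpleGraph V} {p q : ℕ}

theorem bmod_eq_of_eq_add_mul {x y k : ℤ} (h : x = y + p * k) (h₁ : -p < y * 2) (h₂ : y * 2 < p) :
    x.bmod p = y := by
  rw [h, Int.add_mul_bmod_self_left, Int.bmod_eq_of_le_mul_two h₁.le h₂]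

/-- Recolouring a single vertex changes the edge weights by a coboundary. -/
theorem exists_edgeWeight_eq_add_sub (hq : 0 < q) (hpq : p < 4 * q) {f g : Colouring G p q}
    (h : {v | f v ≠ g v}.Subsingleton) :
    ∃ φ : V → ℤ, ∀ u v, G.Adj u v →
      edgeWeight g u v = edgeWeight f u v + (φ v - φ u) := by
  -- The potential is the colour change of least absolute value. Weights lie in `[q, p - q]`, so an
  -- edge weight changes by at most `p - 2 * q < p / 2`, and `bmod` recovers this change whichever
  -- edge is used.
  refine ⟨fun v => Int.bmod ((g v : ℤ) - f v) p, fun u v huv => ?_⟩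
  have hf := f.edgeWeight_mem hq huv
  have hg := g.edgeWeight_mem hq huv
  have ef := edgeWeight_eq f u v
  have eg := edgeWeight_eq g u v
  have hone : f u = g u ∨ f v = g v := by
    by_contra! hc
    exact huv.ne (h hc.1 hc.2)
  rcases hone with e | e
  · have : Int.bmod ((g v : ℤ) - f v) p = edgeWeight g u v - edgeWeight f u v :=
      bmod_eq_of_eq_add_mul (k := (if f v < f u then 1 else 0) - (if g v < g u then 1 else 0))
        (by rw [ef, eg, e]; ring) (by omega) (by omega)
    simp only [e, sub_self, Int.zero_bmod, this]
    ring
  · have : Int.bmod ((g u : ℤ) - f u) p = edgeWeight f u v - edgeWeight g u v :=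
      bmod_eq_of_eq_add_mul (k := (if g v < g u then 1 else 0) - (if f v < f u then 1 else 0))
        (by rw [ef, eg, e]; ring) (by omega) (by omega)
    simp only [e, sub_self, Int.zero_bmod, this]
    ring

theorem walkWeight_eq_dartSum (f : V → Fin p) {u v : V} (X : G.Walk u v) :
    walkWeight f X = dartSum (edgeWeight f) X := rfl

/-- The weight of a closed walk is an invariant of the component of the reconfiguration graph. -/
theorem walkWeight_eq_of_reachable (hq : 0 < q) (hpq : p < 4 * q) {f g : Colouring G p q}
    (h : (reconfigurationGraph G (circularClique p q)).Reachable f g) {u : V} (X : G.Walk u u) :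
    walkWeight f X = walkWeight g X := by
  obtain ⟨P⟩ := h
  induction P with
  | nil => rfl
  | cons hadj _ ih =>
    obtain ⟨φ, hφ⟩ := exists_edgeWeight_eq_add_sub hq hpq hadj.2
    rw [← ih, walkWeight_eq_dartSum, walkWeight_eq_dartSum, dartSum_eq_add_sub hφ]
    ring

/-- The colouring obtained by reversing the order of the colours. -/
def Colouring.rev (f : Colouring G p q) : Colouring G p q where
  toFun v := (f v).rev
  map_rel' {u v} h := by
    obtain ⟨h₀, h₁⟩ := f.map_adj h
    refine ⟨fun e => h₀ (Fin.rev_injective e), ?_⟩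
    have e : (((f u).rev : ℕ) : ℤ) - ((f v).rev : ℕ) = (f v : ℤ) - (f u : ℤ) := by
      have := (f u).isLt
      have := (f v).isLt
      simp only [Fin.val_rev]
      omega
    rwa [e, abs_sub_comm]

theorem Colouring.edgeWeight_rev (f : Colouring G p q) {u v : V} (h : G.Adj u v) :
    edgeWeight f.rev u v = p - edgeWeight f u v := by
  have e : edgeWeight f.rev u v = edgeWeight f v u := by
    have := (f u).isLt
    have := (f v).isLt
    change (((f v).rev : ℕ) - ((f u).rev : ℕ) : ℤ) % p = ((f u : ℤ) - (f v : ℤ)) % p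
    congr 1
    simp only [Fin.val_rev]
    omega
  rw [e, ← f.edgeWeight_add_edgeWeight_swap h]
  ring

theorem Colouring.walkWeight_rev (f : Colouring G p q) {u v : V} (X : G.Walk u v) :
    walkWeight f.rev X = X.length * p - walkWeight f X := by
  simp only [walkWeight_eq_dartSum]
  induction X with
  | nil => simp
  | cons h X ih =>
    rw [dartSum_cons, dartSum_cons, ih, f.edgeWeight_rev h, Walk.length_cons]
    push_cast
    ring

/-- In a mixing graph every closed walk has weight half its length times `p`. -/
theorem IsMixing.two_mul_walkWeight (hq : 0 < q) (hpq : p < 4 * q) (hG : IsMixing G p q)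
    (f : Colouring G p q) {u : V} (X : G.Walk u u) :
    2 * walkWeight f X = X.length * p := by
  have h := walkWeight_eq_of_reachable hq hpq (hG f f.rev) X
  rw [f.walkWeight_rev] at h
  linarith

end Invariance

/-! ### Integer lifts and moves between them -/

section Lift

variable {V : Type*} {G : SimpleGraph V} {p q : ℕ} {s : V → ℤ}

/-- `H` is an integer lift of a `(p,q)`-colouring of `G`, a graph with bipartition given by the
`{0,1}`-valued function `s`: for adjacent `u ∈ s⁻¹ 0` and `v ∈ s⁻¹ 1` the difference
`H v - H u` lies between `q` and `p - q`. -/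
def IsLift (G : SimpleGraph V) (p q : ℕ) (s H : V → ℤ) : Prop :=
  ∀ u v, G.Adj u v → (q : ℤ) ≤ H v - H u + p * s u ∧ H v - H u + p * s u ≤ (p : ℤ) - q

/-- The residue of an integer modulo `p`, as an element of `Fin p`. -/
def toFin (p : ℕ) [NeZero p] (a : ℤ) : Fin p :=
  ⟨(a % p).toNat, by
    have := NeZero.pos p
    have := Int.emod_nonneg a (b := p) (by omega)
    have := Int.emod_lt_of_pos a (b := p) (by omega)
    omega⟩

theorem coe_toFin (p : ℕ) [NeZero p] (a : ℤ) : ((toFin p a : ℕ) : ℤ) = a % p := by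
  have := NeZero.pos p
  have := Int.emod_nonneg a (b := p) (by omega)
  simp only [toFin]
  omega

theorem toFin_eq_of_eq_add_mul [NeZero p] {a b k : ℤ} (h : a = b + p * k) :
    toFin p a = toFin p b := by
  rw [Fin.ext_iff, ← Int.natCast_inj, coe_toFin, coe_toFin, h, Int.add_mul_emod_self_left]

theorem toFin_coe [NeZero p] (a : Fin p) : toFin p (a : ℤ) = a := by
  rw [Fin.ext_iff, ← Int.natCast_inj, coe_toFin, Int.emod_eq_of_lt] <;> omega

/-- The colouring with a given lift. -/
def IsLift.colouring [NeZero p] (hq : 0 < q) {H : V → ℤ} (hH : IsLift G p q s H) :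
    Colouring G p q where
  toFun v := toFin p (H v)
  map_rel' {u v} h := by
    rw [circularClique_adj_iff hq, coe_toFin, coe_toFin, ← Int.sub_emod,
      ← Int.add_mul_emod_self_left _ _ (s u)]
    have := hH u v h
    rwa [Int.emod_eq_of_lt] <;> omega

@[simp]
theorem IsLift.colouring_apply [NeZero p] (hq : 0 < q) {H : V → ℤ} (hH : IsLift G p q s H)
    (v : V) : hH.colouring hq v = toFin p (H v) := rfl

theorem reachable_of_subsingleton {f g : Colouring G p q} (h : {v | f v ≠ g v}.Subsingleton) :
    (reconfigurationGraph G (circularClique p q)).Reachable f g := by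
  by_cases e : f = g
  · rw [e]
  · exact Adj.reachable ⟨e, h⟩

/-- A lift that lies below another one, but is not equal to it, can be raised at some vertex. -/
theorem IsLift.exists_isLift_update [Finite V] [DecidableEq V] (hpq : 2 * q < p)
    (hs : ∀ u v, G.Adj u v → s u + s v = 1) {H K : V → ℤ}
    (hH : IsLift G p q s H) (hK : IsLift G p q s K) (hle : H ≤ K) (hne : H ≠ K) :
    ∃ v, H v < K v ∧ IsLift G p q s (Function.update H v (H v + 1)) := by
  obtain ⟨v₀, hv₀⟩ : ∃ v, H v < K v := by
    by_contra! h
    exact hne (le_antisymm hle h)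
  -- A neighbour `u` blocking the raise of `v` also satisfies `H u < K u`, and its value of this
  -- function is smaller by `p - 2 * q > 0`.
  obtain ⟨v, hv, hmin⟩ := Set.exists_min_image {v | H v < K v} (fun v => 2 * H v - p * s v)
    (Set.toFinite _) ⟨v₀, hv₀⟩
  have hvu : ∀ u, G.Adj u v → H v + 1 - H u + p * s u ≤ (p : ℤ) - q := by
    intro u hu
    by_contra! hlt
    have h₁ := hH u v hu
    have h₂ := hK u v hu
    have hv' : H v < K v := hv
    have h₃ := hmin u (show H u < K u by omega)
    have e : s v = 1 - s u := by linarith [hs u v hu]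
    rw [e, mul_sub] at h₃
    omega
  refine ⟨v, hv, fun a b hab => ?_⟩
  have h₁ := hH a b hab
  by_cases hb : b = v
  · subst hb
    have := hvu a hab
    rw [Function.update_self, Function.update_of_ne hab.ne]
    omega
  by_cases ha : a = v
  · subst ha
    -- Since `s a + s b = 1`, the lower bound for `a b` is the upper bound for `b a`.
    have h₂ := hvu b hab.symm
    have e : s b = 1 - s a := by linarith [hs a b hab]
    rw [e, mul_sub] at h₂
    rw [Function.update_self, Function.update_of_ne hb]
    omega
  · rwa [Function.update_of_ne ha, Function.update_of_ne hb]

/-- Colourings with comparable lifts can be transformed into each other. -/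
theorem IsLift.reachable_of_le [Finite V] [NeZero p] (hq : 0 < q) (hpq : 2 * q < p)
    (hs : ∀ u v, G.Adj u v → s u + s v = 1) {H K : V → ℤ}
    (hH : IsLift G p q s H) (hK : IsLift G p q s K) (hle : H ≤ K) :
    (reconfigurationGraph G (circularClique p q)).Reachable
      (hH.colouring hq) (hK.colouring hq) := by
  classical
  have := Fintype.ofFinite V
  obtain ⟨n, hn⟩ : ∃ n : ℕ, ∑ v, (K v - H v) = n :=
    Int.eq_ofNat_of_zero_le (Finset.sum_nonneg fun v _ => sub_nonneg.2 (hle v))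
  induction n generalizing H with
  | zero =>
    have h := (Finset.sum_eq_zero_iff_of_nonneg fun v _ => sub_nonneg.2 (hle v)).1 hn
    obtain rfl : H = K := funext fun v => by linarith [h v (Finset.mem_univ v)]
    rfl
  | succ n ih =>
    have hne : H ≠ K := by
      rintro rfl
      simp at hn
      omega
    obtain ⟨v, hv, hH'⟩ := hH.exists_isLift_update hpq hs hK hle hne
    refine (reachable_of_subsingleton (g := hH'.colouring hq) ?_).trans (ih hH' ?_ ?_)
    · have hmem : ∀ a ∈ {a | hH.colouring hq a ≠ hH'.colouring hq a}, a = v := by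
        intro a ha
        by_contra hav
        exact ha (by simp [Function.update_of_ne hav])
      exact fun a ha b hb => (hmem a ha).trans (hmem b hb).symm
    · intro a
      by_cases ha : a = v
      · subst ha
        simpa using hv
      · simpa [Function.update_of_ne ha] using hle a
    · have e : ∑ a, (K a - Function.update H v (H v + 1) a) = ∑ a, (K a - H a) - 1 := by
        rw [Finset.sum_sub_distrib, Finset.sum_sub_distrib,
          Finset.sum_update_of_mem (Finset.mem_univ v),
          Finset.sum_eq_add_sum_sdiff_singleton_of_mem (Finset.mem_univ v) H]
        ring
      rw [e, hn]
      push_cast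
      ring

/-- All colourings that have a lift can be transformed into each other. -/
theorem IsLift.reachable [Finite V] [NeZero p] (hq : 0 < q) (hpq : 2 * q < p)
    (hs : ∀ u v, G.Adj u v → s u + s v = 1) {H K : V → ℤ}
    (hH : IsLift G p q s H) (hK : IsLift G p q s K) :
    (reconfigurationGraph G (circularClique p q)).Reachable
      (hH.colouring hq) (hK.colouring hq) := by
  obtain ⟨c, hc⟩ := (Set.finite_range fun v => H v - K v).bddAbove
  -- Shifting by a multiple of `p` keeps the colouring; the maximum with 0 ensures that the shift is
  -- at least `c`.
  have hK' : IsLift G p q s fun v => K v + p * max c 0 := fun u v h => by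
    have := hK u v h
    constructor <;> linarith
  have e : hK'.colouring hq = hK.colouring hq :=
    RelHom.ext fun v => toFin_eq_of_eq_add_mul rfl
  rw [← e]
  refine hH.reachable_of_le hq hpq hs hK' fun v => ?_
  have h₁ : H v - K v ≤ c := hc ⟨v, rfl⟩
  have h₂ : (1 : ℤ) * max c 0 ≤ p * max c 0 :=
    mul_le_mul_of_nonneg_right (by have := NeZero.pos p; omega) (le_max_right _ _)
  have h₃ := le_max_left c 0
  change H v ≤ K v + p * max c 0
  linarith

end Lift

/-! ### Lifting balanced colourings -/

section Balanced

variable {V : Type*} {G : SimpleGraph V} {p q : ℕ}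

/-- A graph in which all cycles have even length is bipartite. -/
theorem exists_bipartition (h : ∀ (c : V) (C : G.Walk c c), C.IsCycle → Even C.length) :
    ∃ s : V → ℤ, ∀ u v, G.Adj u v → s u + s v = 1 := by
  have hlen : ∀ {u v : V} (X : G.Walk u v), dartSum (fun _ _ => (1 : ZMod 2)) X = X.length := by
    intro u v X
    simp [dartSum]
  obtain ⟨t, ht⟩ := exists_potential (G := G) (w := fun _ _ => (1 : ZMod 2))
    (fun _ _ _ => by decide)
    (fun c C hC => by rw [hlen]; exact (ZMod.natCast_eq_zero_iff_even).2 (h c C hC))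
  refine ⟨fun v => (t v).val, fun u v huv => ?_⟩
  have key : ∀ a b : ZMod 2, b - a = 1 → ((a.val : ℤ) + (b.val : ℤ)) = 1 := by decide
  exact key _ _ (ht u v huv)

/-- A colouring under which all cycles have weight half their length times `p` has a lift. -/
theorem Colouring.exists_isLift [NeZero p] (hq : 0 < q) {s : V → ℤ}
    (hs : ∀ u v, G.Adj u v → s u + s v = 1) (f : Colouring G p q)
    (hf : ∀ (c : V) (C : G.Walk c c), C.IsCycle → 2 * walkWeight f C = C.length * p) :
    ∃ (H : V → ℤ) (hH : IsLift G p q s H), hH.colouring hq = f := by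
  have hp : (p : ℤ) ≠ 0 := by exact_mod_cast NeZero.ne p
  -- `p * w u v` is the error of `f` itself as a lift on the edge; `f + p * k` is a lift once `w` is
  -- the coboundary of `k`.
  let w : V → V → ℤ := fun u v => (if f v < f u then 1 else 0) - s u
  have hw (u v : V) : edgeWeight f u v = (f v : ℤ) - f u + p * s u + p * w u v := by
    rw [edgeWeight_eq]
    ring
  have hanti : ∀ u v, G.Adj u v → w u v + w v u = 0 := by
    intro u v h
    have h₁ := f.edgeWeight_add_edgeWeight_swap h
    rw [hw, hw] at h₁
    have h₂ := hs u v h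
    apply mul_left_cancel₀ hp
    linear_combination h₁ - p * h₂
  -- On an edge `2 * s u = 1 + (s u - s v)`, so after doubling, the `s` terms give `length * p` and
  -- a telescoping part.
  have hsum : ∀ {u v : V} (X : G.Walk u v), 2 * p * dartSum w X =
      2 * walkWeight f X - X.length * p
        + ((p * s v - 2 * f v : ℤ) - (p * s u - 2 * f u : ℤ)) := by
    intro u v X
    rw [walkWeight_eq_dartSum]
    induction X with
    | nil => simp
    | @cons a b c h X ih =>
      rw [dartSum_cons, dartSum_cons, mul_add, ih, hw, Walk.length_cons]
      have h₂ := hs a b h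
      push_cast
      linear_combination (-(p : ℤ)) * h₂
  obtain ⟨k, hk⟩ := exists_potential hanti fun c C hC => by
    have h := hsum C
    rw [hf c C hC, sub_self, sub_self, add_zero] at h
    simpa [NeZero.ne p] using h
  have hH : IsLift G p q s fun v => f v + p * k v := by
    intro u v h
    have h₁ := f.edgeWeight_mem hq h
    rw [hw, ← hk u v h] at h₁
    constructor <;> linarith
  exact ⟨_, hH, RelHom.ext fun v => (toFin_eq_of_eq_add_mul rfl).trans (toFin_coe _)⟩

/-- A graph is mixing if under every colouring all cycles have weight half their length
times `p`. -/
theorem isMixing_of_two_mul_walkWeight [Finite V] (hq : 0 < q) (hpq : 2 * q < p)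
    (h : ∀ (f : Colouring G p q) (c : V) (C : G.Walk c c), C.IsCycle →
      2 * walkWeight f C = C.length * p) : IsMixing G p q := by
  intro f g
  have : NeZero p := ⟨by omega⟩
  have hp : (p : ℤ) ≠ 0 := by exact_mod_cast NeZero.ne p
  obtain ⟨s, hs⟩ := exists_bipartition (G := G) fun c C hC => by
    have e := h f c C hC
    rw [walkWeight_eq_mul_wind] at e
    have e' : (C.length : ℤ) = 2 * wind f C := mul_left_cancel₀ hp (by linarith)
    have : Even (C.length : ℤ) := e' ▸ even_two_mul _
    exact_mod_cast this
  obtain ⟨H, hH, rfl⟩ := Colouring.exists_isLift hq hs f (h f)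
  obtain ⟨K, hK, rfl⟩ := Colouring.exists_isLift hq hs g (h g)
  exact hH.reachable hq hpq hs hK

/-- A graph is mixing iff under every colouring all cycles have weight half their length
times `p`. -/
theorem isMixing_iff_two_mul_walkWeight [Finite V] (hpq₂ : 2 * q < p) (hpq₄ : p < 4 * q) :
    IsMixing G p q ↔ ∀ (f : Colouring G p q) (c : V) (C : G.Walk c c), C.IsCycle →
      2 * walkWeight f C = C.length * p :=
  ⟨fun h f _ C _ => h.two_mul_walkWeight (by omega) hpq₄ f C,
    isMixing_of_two_mul_walkWeight (by omega) hpq₂⟩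

end Balanced

end CircularMixing

theorem theorem2p3 {V : Type*} [Finite V] (G : SimpleGraph V) (p q : ℕ)
    (hpq₂ : (2 : ℚ) < (p : ℚ) / (q : ℚ)) (hpq₄ : (p : ℚ) / (q : ℚ) < 4) :
    (CircularMixing.IsMixing G p q ↔
      ∀ (f : CircularMixing.Colouring G p q) (c : V) (C : G.Walk c c), C.IsCycle →
        (CircularMixing.wind f C : ℚ) = (C.length : ℚ) / 2) ∧
    (¬ CircularMixing.IsMixing G p q ↔
      ∃ (f : CircularMixing.Colouring G p q) (c : V) (C : G.Walk c c), C.IsCycle ∧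
        (CircularMixing.walkWeight f C : ℚ) ≠ (C.length : ℚ) / 2 * (p : ℚ)) := by
  -- For `q = 0` the quotient is 0 by convention.
  have hq : q ≠ 0 := by
    rintro rfl
    norm_num at hpq₂
  have hq' : (0 : ℚ) < q := by positivity
  rw [lt_div_iff₀ hq'] at hpq₂
  rw [div_lt_iff₀ hq'] at hpq₄
  have h₂ : 2 * q < p := by exact_mod_cast hpq₂
  have h₄ : p < 4 * q := by exact_mod_cast hpq₄
  have hp : (p : ℚ) ≠ 0 := by
    have : p ≠ 0 := by omega
    exact_mod_cast this
  have hweight : ∀ (f : CircularMixing.Colouring G p q) (c : V) (C : G.Walk c c),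
      2 * CircularMixing.walkWeight f C = C.length * p ↔
        (CircularMixing.walkWeight f C : ℚ) = (C.length : ℚ) / 2 * (p : ℚ) := by
    intro f c C
    rw [← Int.cast_inj (α := ℚ)]
    push_cast
    constructor <;> intro h <;> linarith
  have hwind : ∀ (f : CircularMixing.Colouring G p q) (c : V) (C : G.Walk c c),
      (CircularMixing.walkWeight f C : ℚ) = (C.length : ℚ) / 2 * (p : ℚ) ↔
        (CircularMixing.wind f C : ℚ) = (C.length : ℚ) / 2 := by
    intro f c C
    rw [CircularMixing.walkWeight_eq_mul_wind]
    push_cast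
    rw [mul_comm, mul_left_inj' hp]
  rw [CircularMixing.isMixing_iff_two_mul_walkWeight h₂ h₄]
  constructor
  · simp only [hweight, hwind]
  · simp only [hweight]
    push Not
    rfl
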